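/- Let $B$ be a closed 3-ball in $\mathbb R^3$ touching the four corners of a square in the $xy$-plane, viewed from the side $z>0$; label the corners $1,2,3,4$ counterclockwise, starting from the bottom left. A tangle is a union of two disjoint arcs in $B$ that meet $\partial B$ exactly in their endpoints, these endpoints being the four corners; tangles are considered up to ambient isotopy of $B$ fixing $\partial B$ pointwise. The turn $R$ rotates a tangle counterclockwise by a quarter turn, carrying the ends at $1,2,3,4$ to $2,3,4,1$. The twist $T$ exchanges the ends at positions $1$ and $2$ by a half twist, the end from $1$ passing over (in front of) the end from $2$, and leaves the ends at $3$ and $4$ where they are. The moves $R$ and $T$ are invertible on isotopy classes of tangles, so the free group on the letters $R$ and $T$ acts on these classes; in a word the rightmost letter is performed first. The untangle consists of two uncrossed ropes, one joining $1$ to $4$ and one joining $2$ to $3$. A rational tangle is a tangle (up to isotopy) obtained from the untangle by a finite sequence of moves $T$ and $R$. Let $W$ be a word in the letters $R$ and $T$ and their inverses. Then there is a word $W^+$ in the letters $R$ and $T$ only such that for every rational tangle $\tau$, $$W\cdot\tau = W^+\cdot\tau .$$ -/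

import Mathlib

open scoped unitInterval

namespace TangleTrick

noncomputable section

/-- The ball in which the ropes live: a pillow-shaped closed `3`-ball in `ℝ³`, lying over the
square `[-1, 1]²` of the `xy`-plane. It is star-shaped about the origin, every ray from the origin
leaves it exactly once, and it touches the corners of the square. The audience looks at it from
the side `z > 0`, with the `x`-axis pointing to the right and the `y`-axis pointing up. -/
def pillow : Set (ℝ × ℝ × ℝ) :=
  {p | p.1 ^ 2 ≤ 1 ∧ p.2.1 ^ 2 ≤ 1 ∧ p.2.2 ^ 2 ≤ (1 - p.1 ^ 2) * (1 - p.2.1 ^ 2)}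

/-- The closed `3`-ball as a topological space (with the topology induced from `ℝ³`). -/
abbrev Ball : Type := ↥pillow

/-- The boundary sphere of the ball. -/
def sphere : Set Ball :=
  {p | p.1.2.2 ^ 2 = (1 - p.1.1 ^ 2) * (1 - p.1.2.1 ^ 2)}

/-- The four corners of the square, where the volunteers stand: position `1` is `(-1, -1, 0)`,
position `2` is `(1, -1, 0)`, position `3` is `(1, 1, 0)`, position `4` is `(-1, 1, 0)`. -/
def corners : Set Ball :=
  {p | p.1 = (-1, -1, 0) ∨ p.1 = (1, -1, 0) ∨ p.1 = (1, 1, 0) ∨ p.1 = (-1, 1, 0)}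

/-- A state of the two ropes: the union of two disjoint arcs in the ball that meet the boundary
sphere exactly in their end points, the four end points being the four corners. -/
structure Tangle where
  carrier : Set Ball
  isTangle : ∃ f : Fin 2 × I → Ball, Continuous f ∧ Function.Injective f ∧
    Set.range f = carrier ∧ (∀ q, f q ∈ sphere ↔ q.2 = 0 ∨ q.2 = 1) ∧
    f '' {q | q.2 = 0 ∨ q.2 = 1} = corners

/-- Two tangles are isotopic if some ambient isotopy of the ball, fixing the boundary sphere
pointwise, carries the first to the second. -/
def Isotopic (s t : Tangle) : Prop :=
  ∃ H : I → (Ball ≃ₜ Ball), Continuous (fun q : I × Ball => H q.1 q.2) ∧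
    H 0 = Homeomorph.refl Ball ∧ (∀ u, ∀ p ∈ sphere, H u p = p) ∧ H 1 '' s.carrier = t.carrier

theorem Isotopic.refl (s : Tangle) : Isotopic s s := by
  refine ⟨fun _ => Homeomorph.refl Ball, continuous_snd, rfl, fun _ _ _ => rfl, ?_⟩
  simp

theorem Isotopic.symm {s t : Tangle} (h : Isotopic s t) : Isotopic t s := by
  obtain ⟨H, hc, h0, hf, h1⟩ := h
  refine ⟨fun u => (H 1).symm.trans (H (σ u)), ?_, ?_, ?_, ?_⟩
  · exact hc.comp ((unitInterval.continuous_symm.comp continuous_fst).prodMk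
      ((H 1).symm.continuous.comp continuous_snd))
  · ext1 p
    simp
  · intro u p hp
    have : (H 1).symm p = p := by
      rw [Homeomorph.symm_apply_eq, hf 1 p hp]
    simp [this, hf _ p hp]
  · rw [← h1, ← Set.image_comp]
    simp [h0]

theorem Isotopic.trans {r s t : Tangle} (h : Isotopic r s) (k : Isotopic s t) :
    Isotopic r t := by
  obtain ⟨H, hc, h0, hf, h1⟩ := h
  obtain ⟨K, kc, k0, kf, k1⟩ := k
  refine ⟨fun u => (H u).trans (K u), ?_, ?_, ?_, ?_⟩
  · exact kc.comp (continuous_fst.prodMk hc)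
  · ext1 p
    simp [h0, k0]
  · intro u p hp
    simp [hf u p hp, kf u p hp]
  · rw [← k1, ← h1, ← Set.image_comp]
    rfl

instance tangleSetoid : Setoid Tangle where
  r := Isotopic
  iseqv := ⟨Isotopic.refl, Isotopic.symm, Isotopic.trans⟩

/-- Tangles up to isotopy. -/
def TangleClass : Type := Quotient tangleSetoid

/-- Homeomorphisms of the ball that preserve the boundary sphere and the set of corners. -/
structure BallMove where
  toHomeo : Ball ≃ₜ Ball
  map_sphere : ∀ p, toHomeo p ∈ sphere ↔ p ∈ sphere
  map_corners : ∀ p, toHomeo p ∈ corners ↔ p ∈ corners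

/-- The inverse homeomorphism. -/
def BallMove.inv (h : BallMove) : BallMove where
  toHomeo := h.toHomeo.symm
  map_sphere p := by simpa using (h.map_sphere (h.toHomeo.symm p)).symm
  map_corners p := by simpa using (h.map_corners (h.toHomeo.symm p)).symm

/-- Carrying a tangle along by a homeomorphism of the ball. -/
def BallMove.mapTangle (h : BallMove) (t : Tangle) : Tangle where
  carrier := h.toHomeo '' t.carrier
  isTangle := by
    obtain ⟨f, hc, hi, hr, hs, he⟩ := t.isTangle
    refine ⟨fun q => h.toHomeo (f q), h.toHomeo.continuous.comp hc,
      h.toHomeo.injective.comp hi, ?_, ?_, ?_⟩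
    · rw [← hr, ← Set.range_comp]
      rfl
    · intro q
      rw [h.map_sphere, hs]
    · have : (fun q => h.toHomeo (f q)) = h.toHomeo ∘ f := rfl
      rw [this, Set.image_comp, he]
      ext p
      constructor
      · rintro ⟨q, hq, rfl⟩
        exact (h.map_corners q).2 hq
      · intro hp
        refine ⟨h.toHomeo.symm p, ?_, by simp⟩
        rw [← h.map_corners]
        simpa using hp

theorem BallMove.mapTangle_isotopic (h : BallMove) {s t : Tangle} (hst : Isotopic s t) :
    Isotopic (h.mapTangle s) (h.mapTangle t) := by
  obtain ⟨H, hc, h0, hf, h1⟩ := hst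
  refine ⟨fun u => (h.toHomeo.symm.trans (H u)).trans h.toHomeo, ?_, ?_, ?_, ?_⟩
  · exact h.toHomeo.continuous.comp (hc.comp (continuous_fst.prodMk
      (h.toHomeo.symm.continuous.comp continuous_snd)))
  · ext1 p
    simp [h0]
  · intro u p hp
    have : h.toHomeo.symm p ∈ sphere := by
      rw [← h.map_sphere]
      simpa using hp
    simp [hf u _ this]
  · change _ '' (h.toHomeo '' s.carrier) = h.toHomeo '' t.carrier
    rw [← h1, ← Set.image_comp, ← Set.image_comp]
    congr 1
    ext1 p
    simp

/-- The permutation of the isotopy classes of tangles induced by a homeomorphism of the ball. -/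
def BallMove.perm (h : BallMove) : Equiv.Perm TangleClass where
  toFun := Quotient.map h.mapTangle fun _ _ => h.mapTangle_isotopic
  invFun := Quotient.map h.inv.mapTangle fun _ _ => h.inv.mapTangle_isotopic
  left_inv := by
    intro τ
    induction τ using Quotient.inductionOn with
    | h t =>
      refine congrArg (Quotient.mk _) ?_
      cases t
      simp [BallMove.mapTangle, BallMove.inv, ← Set.image_comp]
  right_inv := by
    intro τ
    induction τ using Quotient.inductionOn with
    | h t =>
      refine congrArg (Quotient.mk _) ?_
      cases t
      simp [BallMove.mapTangle, BallMove.inv, ← Set.image_comp]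

theorem twist_mem {x y z : ℝ} (h : (x, y, z) ∈ pillow) :
    (x * y + z, y, y * z - (1 - y ^ 2) * x) ∈ pillow := by
  obtain ⟨hx, hy, hz⟩ := h
  simp only at hx hy hz
  refine ⟨?_, hy, ?_⟩
  · simp only
    rcases hy.lt_or_eq with hy' | hy'
    · have h1 : 0 < 1 - y ^ 2 := by linarith
      have h2 : (x * y + z) ^ 2 * (1 - y ^ 2) ≤ 1 * (1 - y ^ 2) := by
        nlinarith [sq_nonneg (y * z - (1 - y ^ 2) * x)]
      exact le_of_mul_le_mul_right h2 h1
    · have h1 : z = 0 := by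
        rw [hy'] at hz
        have : z ^ 2 ≤ 0 := by linarith
        exact pow_eq_zero_iff two_ne_zero |>.1 (le_antisymm this (sq_nonneg z))
      rw [h1, add_zero, mul_pow, hy', mul_one]
      exact hx
  · simp only
    nlinarith

theorem twistInv_mem {x y z : ℝ} (h : (x, y, z) ∈ pillow) :
    (x * y - z, y, y * z + (1 - y ^ 2) * x) ∈ pillow := by
  have h' : (-x, y, z) ∈ pillow := by simpa [pillow] using h
  have := twist_mem h'
  simp only [pillow, Set.mem_ofPred_eq] at this ⊢
  refine ⟨?_, this.2.1, ?_⟩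
  · nlinarith [this.1]
  · nlinarith [this.2.2]

/-- The homeomorphism of the twist. For `-1 < y < 1` the slice of the ball at height `y` is the
elliptical disc `x ^ 2 + z ^ 2 / (1 - y ^ 2) ≤ 1`; it is turned about the `y`-axis by the angle
`arccos y`, that is
`(x, z / √(1 - y ^ 2)) ↦ (x cos θ + (z / √(1 - y ^ 2)) sin θ, -x sin θ + (z / √(1 - y ^ 2)) cos θ)`
with `cos θ = y` and `sin θ = √(1 - y ^ 2)`. So the angle grows from `0` at the top edge to half
a turn at the bottom edge: positions `3` and `4` stay, positions `1` and `2` are exchanged, and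
in this half turn the left end passes in front (`z > 0`) and the right end passes behind. -/
def twistHomeo : Ball ≃ₜ Ball where
  toFun p := ⟨(p.1.1 * p.1.2.1 + p.1.2.2, p.1.2.1,
    p.1.2.1 * p.1.2.2 - (1 - p.1.2.1 ^ 2) * p.1.1), twist_mem p.2⟩
  invFun p := ⟨(p.1.1 * p.1.2.1 - p.1.2.2, p.1.2.1,
    p.1.2.1 * p.1.2.2 + (1 - p.1.2.1 ^ 2) * p.1.1), twistInv_mem p.2⟩
  left_inv := by
    rintro ⟨⟨x, y, z⟩, h⟩
    simp only [Subtype.mk.injEq, Prod.mk.injEq, true_and]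
    constructor <;> ring
  right_inv := by
    rintro ⟨⟨x, y, z⟩, h⟩
    simp only [Subtype.mk.injEq, Prod.mk.injEq, true_and]
    constructor <;> ring
  continuous_toFun := by fun_prop
  continuous_invFun := by fun_prop

/-- The homeomorphism of the turn: the counterclockwise quarter turn about the `z`-axis. -/
def turnHomeo : Ball ≃ₜ Ball where
  toFun p := ⟨(-p.1.2.1, p.1.1, p.1.2.2), by
    obtain ⟨⟨x, y, z⟩, h⟩ := p
    simp only [pillow, Set.mem_ofPred_eq, neg_sq] at h ⊢
    exact ⟨h.2.1, h.1, by linarith [h.2.2]⟩⟩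
  invFun p := ⟨(p.1.2.1, -p.1.1, p.1.2.2), by
    obtain ⟨⟨x, y, z⟩, h⟩ := p
    simp only [pillow, Set.mem_ofPred_eq, neg_sq] at h ⊢
    exact ⟨h.2.1, h.1, by linarith [h.2.2]⟩⟩
  left_inv := by
    rintro ⟨⟨x, y, z⟩, h⟩
    simp
  right_inv := by
    rintro ⟨⟨x, y, z⟩, h⟩
    simp
  continuous_toFun := by fun_prop
  continuous_invFun := by fun_prop

/-- The twist `T`: the ropes at positions `1` and `2` are exchanged, `1` passing over `2`. -/
def twist : BallMove where
  toHomeo := twistHomeo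
  map_sphere := by
    rintro ⟨⟨x, y, z⟩, h⟩
    simp only [twistHomeo, sphere, Homeomorph.homeomorph_mk_coe, Equiv.coe_fn_mk,
      Set.mem_ofPred_eq]
    constructor <;> intro h <;> nlinarith
  map_corners := by
    rintro ⟨⟨x, y, z⟩, h⟩
    simp only [twistHomeo, corners, Homeomorph.homeomorph_mk_coe, Equiv.coe_fn_mk,
      Set.mem_ofPred_eq, Prod.mk.injEq]
    constructor
    · rintro (⟨h1, rfl, h3⟩ | ⟨h1, rfl, h3⟩ | ⟨h1, rfl, h3⟩ | ⟨h1, rfl, h3⟩)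
      · exact Or.inr (Or.inl ⟨by linarith, rfl, by linarith⟩)
      · exact Or.inl ⟨by linarith, rfl, by linarith⟩
      · exact Or.inr (Or.inr (Or.inl ⟨by linarith, rfl, by linarith⟩))
      · exact Or.inr (Or.inr (Or.inr ⟨by linarith, rfl, by linarith⟩))
    · rintro (⟨rfl, rfl, rfl⟩ | ⟨rfl, rfl, rfl⟩ | ⟨rfl, rfl, rfl⟩ | ⟨rfl, rfl, rfl⟩) <;> norm_num

/-- The turn `R`: the four volunteers move counterclockwise by one position. -/
def turn : BallMove where
  toHomeo := turnHomeo
  map_sphere := by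
    rintro ⟨⟨x, y, z⟩, h⟩
    simp only [turnHomeo, sphere, Homeomorph.homeomorph_mk_coe, Equiv.coe_fn_mk,
      Set.mem_ofPred_eq, neg_sq]
    rw [mul_comm]
  map_corners := by
    rintro ⟨⟨x, y, z⟩, h⟩
    simp only [turnHomeo, corners, Homeomorph.homeomorph_mk_coe, Equiv.coe_fn_mk,
      Set.mem_ofPred_eq, Prod.mk.injEq, neg_eq_iff_eq_neg, neg_neg]
    tauto

/-- The two ropes of the initial state as parametrized arcs: the left rope joins positions `1`
and `4`, the right rope joins positions `2` and `3`, without crossing. The parameter `t` runs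
over `[0, 1]` and corresponds to the height `y = 2 t - 1`; the ropes bulge slightly inwards, so
that only their ends lie on the boundary sphere. -/
def untangleArc (q : Fin 2 × I) : Ball :=
  ⟨((if q.1 = 0 then -1 else 1) * ((1 + (2 * (q.2 : ℝ) - 1) ^ 2) / 2), 2 * (q.2 : ℝ) - 1, 0), by
    obtain ⟨i, t, h0, h1⟩ := q
    have hs : (if i = 0 then (-1 : ℝ) else 1) ^ 2 = 1 := by split_ifs <;> norm_num
    have hy : (2 * t - 1) ^ 2 ≤ 1 := by nlinarith
    have hx : ((1 + (2 * t - 1) ^ 2) / 2) ^ 2 ≤ 1 := by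
      nlinarith [sq_nonneg (2 * t - 1)]
    simp only [pillow, Set.mem_ofPred_eq, mul_pow, hs, one_mul]
    refine ⟨hx, hy, ?_⟩
    rw [zero_pow two_ne_zero]
    exact mul_nonneg (by linarith) (by linarith)⟩

/-- The untangle: the initial, uncrossed state of the ropes. -/
def untangle : Tangle where
  carrier := Set.range untangleArc
  isTangle := by
    refine ⟨untangleArc, ?_, ?_, rfl, ?_, ?_⟩
    · have h1 : Continuous fun i : Fin 2 => if i = 0 then (-1 : ℝ) else 1 :=
        continuous_of_discreteTopology
      have h2 : Continuous fun q : Fin 2 × I => if q.1 = 0 then (-1 : ℝ) else 1 :=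
        h1.comp continuous_fst
      unfold untangleArc
      fun_prop
    · rintro ⟨i, t, h0, h1⟩ ⟨j, u, k0, k1⟩ h
      simp only [untangleArc, Subtype.mk.injEq, Prod.mk.injEq, and_true] at h
      obtain ⟨h, h'⟩ := h
      have htu : t = u := by linarith
      subst htu
      have hne : (1 + (2 * t - 1) ^ 2) / 2 ≠ 0 := by positivity
      have := mul_right_cancel₀ hne h
      fin_cases i <;> fin_cases j <;> simp at this ⊢ <;> norm_num at this
    · rintro ⟨i, t, h0, h1⟩
      have hs : (if i = 0 then (-1 : ℝ) else 1) ^ 2 = 1 := by split_ifs <;> norm_num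
      simp only [untangleArc, sphere, Set.mem_ofPred_eq, mul_pow, hs, one_mul, Subtype.ext_iff,
        Set.Icc.coe_zero, Set.Icc.coe_one]
      constructor
      · intro h
        have h2 : (t * (1 - t)) ^ 2 * (3 + (2 * t - 1) ^ 2) = 0 := by
          nlinarith
        have h3 : (3 + (2 * t - 1) ^ 2) ≠ 0 := by positivity
        have h4 := (mul_eq_zero.1 h2).resolve_right h3
        rcases mul_eq_zero.1 (pow_eq_zero_iff two_ne_zero |>.1 h4) with h5 | h5
        · exact Or.inl h5
        · exact Or.inr (by linarith)
      · rintro (rfl | rfl) <;> norm_num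
    · ext ⟨⟨x, y, z⟩, h⟩
      simp only [untangleArc, corners, Set.mem_image, Set.mem_ofPred_eq, Prod.exists,
        Subtype.mk.injEq, Prod.mk.injEq]
      constructor
      · rintro ⟨i, t, rfl | rfl, rfl, rfl, rfl⟩ <;> fin_cases i <;> norm_num
      · rintro (⟨rfl, rfl, rfl⟩ | ⟨rfl, rfl, rfl⟩ | ⟨rfl, rfl, rfl⟩ | ⟨rfl, rfl, rfl⟩)
        · exact ⟨0, 0, Or.inl rfl, by norm_num⟩
        · exact ⟨1, 0, Or.inl rfl, by norm_num⟩
        · exact ⟨1, 1, Or.inr rfl, by norm_num⟩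
        · exact ⟨0, 1, Or.inr rfl, by norm_num⟩

/-- The two letters. -/
inductive Move where
  | R
  | T

/-- The permutation of the isotopy classes of tangles performed by a letter. -/
def Move.perm : Move → Equiv.Perm TangleClass
  | .R => turn.perm
  | .T => twist.perm

/-- The free group on `R` and `T` acts on tangles up to isotopy; in a word, the rightmost letter
is performed first. -/
instance tangleAction : MulAction (FreeGroup Move) TangleClass :=
  MulAction.compHom TangleClass (FreeGroup.lift Move.perm)

/-- Rational tangles: the tangles obtained from the untangle by performing `T` and `R` moves. -/
inductive IsRational : TangleClass → Prop
  | untangle : IsRational (Quotient.mk tangleSetoid untangle)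
  | move (m : Move) (τ : TangleClass) : IsRational τ → IsRational (m.perm τ)

end

end TangleTrick

namespace TangleTrick

/-! Two relations suffice: `R ^ 4 = 1` and `(T * R) ^ 3 = 1`. They give `R⁻¹ = R R R` and `T⁻¹ = R T
R T R`, so every inverse letter can be replaced by a positive block. With the chosen models of the
moves, both relations hold pointwise for the homeomorphisms of the ball (`turnHomeo_four`,
`twistHomeo_turnHomeo_three`). No isotopy has to be constructed, and the replacement works on all
tangle classes. -/

/-- A composite of four quarter turns is the identity of the ball. -/
theorem turnHomeo_four (p : Ball) :
    turnHomeo (turnHomeo (turnHomeo (turnHomeo p))) = p := by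
  obtain ⟨⟨x, y, z⟩, h⟩ := p
  simp [turnHomeo]

/-- Turning and then twisting is a homeomorphism of the ball of order three. -/
theorem twistHomeo_turnHomeo_three (p : Ball) :
    twistHomeo (turnHomeo (twistHomeo (turnHomeo (twistHomeo (turnHomeo p))))) = p := by
  obtain ⟨⟨x, y, z⟩, h⟩ := p
  simp only [turnHomeo, twistHomeo, Homeomorph.homeomorph_mk_coe, Equiv.coe_fn_mk,
    Subtype.mk.injEq, Prod.mk.injEq]
  -- In the coordinates `(x, y, w)` with `w = z - x * y`, turning and then twisting is the cyclic
  -- shift `(x, y, w) ↦ (w, x, y)`, and the ball is `x² + y² + w² + 2xyw ≤ 1`, which is symmetric in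
  -- the three. Hence the cube is the identity, as a polynomial identity on all of `ℝ³`.
  refine ⟨?_, ?_, ?_⟩ <;> ring

theorem Tangle.ext_carrier {s t : Tangle} (h : s.carrier = t.carrier) : s = t := by
  cases s
  cases t
  cases h
  rfl

/-- The composite fixes every point of the ball, so each representative returns to the same carrier:
the tangles are equal, not merely isotopic. -/
theorem Move.perm_R_pow_four : Move.R.perm ^ 4 = 1 := by
  ext1 τ
  induction τ using Quotient.inductionOn with
  | h t =>
    change Quotient.mk _ (turn.mapTangle (turn.mapTangle (turn.mapTangle (turn.mapTangle t)))) =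
      Quotient.mk _ t
    refine congrArg (Quotient.mk _) (Tangle.ext_carrier ?_)
    simp only [BallMove.mapTangle, turn, Set.image_image, turnHomeo_four, Set.image_id']

theorem Move.perm_T_mul_perm_R_pow_three : (Move.T.perm * Move.R.perm) ^ 3 = 1 := by
  ext1 τ
  induction τ using Quotient.inductionOn with
  | h t =>
    change Quotient.mk _ (twist.mapTangle (turn.mapTangle (twist.mapTangle (turn.mapTangle
      (twist.mapTangle (turn.mapTangle t)))))) = Quotient.mk _ t
    refine congrArg (Quotient.mk _) (Tangle.ext_carrier ?_)
    simp only [BallMove.mapTangle, turn, twist, Set.image_image, twistHomeo_turnHomeo_three,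
      Set.image_id']

/-- A positive word that undoes a letter. -/
def Move.positiveInverse : Move → List Move
  | .R => [.R, .R, .R]
  | .T => [.R, .T, .R, .T, .R]

theorem Move.prod_perm_positiveInverse (m : Move) :
    (m.positiveInverse.map Move.perm).prod = m.perm⁻¹ := by
  -- Putting the letter in front of its block completes `R ^ 4` or `(T * R) ^ 3`.
  refine eq_inv_of_mul_eq_one_right ?_
  cases m with
  | R => simpa [Move.positiveInverse, pow_succ, mul_assoc] using Move.perm_R_pow_four
  | T => simpa [Move.positiveInverse, pow_succ, mul_assoc] using Move.perm_T_mul_perm_R_pow_three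

theorem lift_perm_mk_positive (w : List Move) :
    FreeGroup.lift Move.perm (FreeGroup.mk (w.map fun m => (m, true))) =
      (w.map Move.perm).prod := by
  simp [FreeGroup.lift_mk, Function.comp_def]

/-- Every word in the letters and their inverses acts on all tangle classes, rational or not, as
some positive word does. -/
theorem exists_positive_lift_perm_eq (W : List (Move × Bool)) :
    ∃ w : List Move, FreeGroup.lift Move.perm (FreeGroup.mk W) = (w.map Move.perm).prod := by
  induction W with
  | nil => exact ⟨[], by simp [FreeGroup.lift_mk]⟩
  | cons a W ih =>
    obtain ⟨m, b⟩ := a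
    obtain ⟨w, hw⟩ := ih
    rw [FreeGroup.lift_mk] at hw
    cases b with
    | true => exact ⟨m :: w, by simp [FreeGroup.lift_mk, hw]⟩
    | false =>
      -- The block takes the place of the inverse letter, to the left of the part already made
      -- positive, so the order of the moves is kept.
      exact ⟨m.positiveInverse ++ w, by
        simp [FreeGroup.lift_mk, hw, Move.prod_perm_positiveInverse]⟩

end TangleTrick

/-- A word in `R`, `T` and their inverses is a list of letters with signs (`true` for the letter
itself, `false` for its inverse); a word in `R` and `T` only is a list of letters. -/
theorem mainTheorem5 (W : List (TangleTrick.Move × Bool)) :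
    ∃ Wpos : List TangleTrick.Move, ∀ τ : TangleTrick.TangleClass, TangleTrick.IsRational τ →
      FreeGroup.mk W • τ = FreeGroup.mk (Wpos.map fun m => (m, true)) • τ := by
  obtain ⟨w, hw⟩ := TangleTrick.exists_positive_lift_perm_eq W
  refine ⟨w, fun τ _ => ?_⟩
  -- The action is pulled back along `FreeGroup.lift`, so acting is by definition applying the
  -- lifted permutation, and it is enough to compare two permutations.
  change FreeGroup.lift TangleTrick.Move.perm (FreeGroup.mk W) τ =
    FreeGroup.lift TangleTrick.Move.perm (FreeGroup.mk (w.map fun m => (m, true))) τ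
  rw [hw, TangleTrick.lift_perm_mk_positive]
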